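/- Let $\nu$ be a nonnegative integer, let $X_t=(x_{t1},x_{t2})'$, $t=1,\dots,\nu$, be independent random vectors distributed according to the bivariate normal distribution $N_2(0,I)$ with mean zero and identity covariance matrix, and let $W_2(\nu,I)$ denote the (real, central) Wishart distribution, i.e. the distribution of the random symmetric $2\times 2$ matrix with $(i,j)$ entry $\sum_{t=1}^{\nu}x_{ti}x_{tj}$. Let $(w_{ij})_{1\le i,j\le 2}\sim W_2(\nu,I)$. Then for all nonnegative integers $a,b,c$ the random variable $w_{12}^{2a}w_{11}^{b}w_{22}^{c}$ is integrable and $$E\bigl[w_{12}^{2a}\,w_{11}^{b}\,w_{22}^{c}\bigr]=(2a-1)!!\,\prod_{i=1}^{a}\bigl(\nu+2(a-i)\bigr)\,\prod_{i=1}^{b}\bigl(\nu+2(a+b-i)\bigr)\,\prod_{i=1}^{c}\bigl(\nu+2(a+c-i)\bigr),$$ where $(2a-1)!!=(2a)!/(2^a a!)$ (so $(-1)!!=1$), empty products equal $1$ and $x^0=1$. Moreover, for every odd positive integer $k$ and all nonnegative integers $b,c$, the random variable $w_{12}^{k}w_{11}^{b}w_{22}^{c}$ is integrable and $E\bigl[w_{12}^{k}\,w_{11}^{b}\,w_{22}^{c}\bigr]=0$.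 -/

import Mathlib

open MeasureTheory ProbabilityTheory

open scoped Nat

/-- The Borel σ-algebra on real `p × p` matrices, as the product σ-algebra over the entries. -/
instance measurableSpaceMatrix (p : ℕ) : MeasurableSpace (Matrix (Fin p) (Fin p) ℝ) :=
  inferInstanceAs (MeasurableSpace (Fin p → Fin p → ℝ))

/-- The Gram-type matrix `W = (w_ij)`, `w_ij = ∑ t, x_{ti} x_{tj}`, made of the vectors
`x_1, …, x_ν` of `ℝ^p`. -/
def scatterMatrix {p ν : ℕ} (x : Fin ν → EuclideanSpace ℝ (Fin p)) :
    Matrix (Fin p) (Fin p) ℝ :=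
  Matrix.of fun i j ↦ ∑ t, x t i * x t j

lemma measurable_scatterMatrix {p ν : ℕ} :
    Measurable (scatterMatrix : (Fin ν → EuclideanSpace ℝ (Fin p)) → _) := by
  refine measurable_pi_lambda _ fun i ↦ measurable_pi_lambda _ fun j ↦ ?_
  simp only [scatterMatrix, Matrix.of_apply]
  fun_prop

/-- The (real, central) Wishart distribution `W_p(ν, S)`: the law of
`(∑ t, x_{ti} x_{tj})_{i,j}` where `x_1, …, x_ν` are independent random vectors with the normal
distribution `N_p(0, S)`. It is meant for positive semidefinite `S`. -/
noncomputable def wishart (p ν : ℕ) (S : Matrix (Fin p) (Fin p) ℝ) :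
    Measure (Matrix (Fin p) (Fin p) ℝ) :=
  (Measure.pi fun _ : Fin ν ↦ multivariateGaussian 0 S).map scatterMatrix

instance isProbabilityMeasure_wishart (p ν : ℕ) (S : Matrix (Fin p) (Fin p) ℝ) :
    IsProbabilityMeasure (wishart p ν S) :=
  Measure.isProbabilityMeasure_map measurable_scatterMatrix.aemeasurable

/-!
The proof is by Gaussian integration by parts. For the standard normal law on the line,
`E[x ^ (n + 1)] = n * E[x ^ (n - 1)]`, because the density has derivative `-x` times itself.
Taking products over independent coordinates, `E[x_i * f] = E[∂_i f]` for every polynomial `f`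
(`gaussianExpectation_X_mul`).

The entries `u = w_11`, `v = w_12`, `w = w_22` are quadratic forms in the coordinates, with
`∂_{t1} u = 2 x_{t1}`, `∂_{t1} v = x_{t2}`, `∂_{t1} w = 0`. One factor `u = ∑ t, x_{t1} x_{t1}`
can therefore be removed from a moment by integrating by parts in all the `x_{t1}`:
`E[v ^ k u ^ (b + 1) w ^ c] = (ν + k + 2 b) E[v ^ k u ^ b w ^ c]`
(`gaussianExpectation_scatterPoly_succ`), and likewise for `w`. This reduces everything to the
powers of `v`. Writing one factor of `v ^ (k + 2)` as `∑ t, x_{t1} x_{t2}` gives in the same way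
`E[v ^ (k + 2)] = (k + 1) E[v ^ k w] = (k + 1) (ν + k) E[v ^ k]`
(`gaussianExpectation_scatterPoly_pow_add_two`), together with `E[v] = 0`. The even powers yield
the double factorial and the first product, and the odd moments vanish.
-/

/-! ### Moments of the standard normal distribution -/

lemma integrable_pow_gaussianReal (n : ℕ) :
    Integrable (fun x : ℝ ↦ x ^ n) (gaussianReal 0 1) := by
  refine integrable_pow_of_mem_interior_integrableExpSet (X := fun x ↦ x) ?_ n
  simp [integrableExpSet_fun_id_gaussianReal]

lemma hasDerivAt_gaussianPDFReal (x : ℝ) :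
    HasDerivAt (gaussianPDFReal 0 1) (-(x * gaussianPDFReal 0 1 x)) x := by
  have h : HasDerivAt (fun y : ℝ ↦ (√(2 * Real.pi))⁻¹ * Real.exp (-y ^ 2 / 2))
      ((√(2 * Real.pi))⁻¹ * (Real.exp (-x ^ 2 / 2) * (-(2 * x) / 2))) x := by
    refine ((HasDerivAt.exp ?_).const_mul _)
    simpa using ((hasDerivAt_pow 2 x).neg.div_const 2)
  have e : gaussianPDFReal 0 1 = fun y : ℝ ↦ (√(2 * Real.pi))⁻¹ * Real.exp (-y ^ 2 / 2) := by
    simp [gaussianPDFReal_def]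
  rw [e]
  convert h using 1
  ring

lemma integrable_pow_mul_gaussianPDFReal (n : ℕ) :
    Integrable (fun x : ℝ ↦ x ^ n * gaussianPDFReal 0 1 x) := by
  have h := integrable_pow_gaussianReal n
  rw [gaussianReal_of_var_ne_zero 0 one_ne_zero, integrable_withDensity_iff
    (measurable_gaussianPDF 0 1) (by simp [gaussianPDF_lt_top])] at h
  simpa using h

/-- The truncated subtraction is harmless: for `n = 0` the right side vanishes. -/
lemma integral_pow_succ_gaussianReal (n : ℕ) :
    ∫ x, x ^ (n + 1) ∂gaussianReal 0 1 = n * ∫ x, x ^ (n - 1) ∂gaussianReal 0 1 := by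
  simp only [integral_gaussianReal_eq_integral_smul one_ne_zero, smul_eq_mul]
  have h := integral_mul_deriv_eq_deriv_mul_of_integrable
    (u := fun x : ℝ ↦ x ^ n) (u' := fun x ↦ n * x ^ (n - 1)) (v := gaussianPDFReal 0 1)
    (v' := fun x ↦ -(x * gaussianPDFReal 0 1 x)) (fun x _ ↦ by simpa using hasDerivAt_pow n x)
    (fun x _ ↦ hasDerivAt_gaussianPDFReal x)
    (by
      refine (integrable_pow_mul_gaussianPDFReal (n + 1)).neg.congr (.of_forall fun x ↦ ?_)
      simp only [Pi.neg_apply, Pi.mul_apply]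
      ring)
    (by
      refine ((integrable_pow_mul_gaussianPDFReal (n - 1)).const_mul n).congr
        (.of_forall fun x ↦ ?_)
      simp only [Pi.mul_apply]
      ring)
    (integrable_pow_mul_gaussianPDFReal n)
  rw [← integral_const_mul]
  have h1 : ∫ x, gaussianPDFReal 0 1 x * x ^ (n + 1)
      = -∫ x : ℝ, x ^ n * -(x * gaussianPDFReal 0 1 x) := by
    rw [← integral_neg]
    congr with x
    ring
  rw [h1, h, neg_neg]
  congr with x
  ring

/-! ### Gaussian expectation of polynomials -/

section Polynomial

open MvPolynomial

variable {σ : Type*} [Fintype σ]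

lemma eval_monomial_eq_prod (x : σ → ℝ) (s : σ →₀ ℕ) (r : ℝ) :
    eval x (monomial s r) = r * ∏ i, x i ^ s i := by
  rw [eval_monomial, Finsupp.prod_fintype _ _ (by simp)]

lemma integrable_eval_pi_gaussianReal (p : MvPolynomial σ ℝ) :
    Integrable (fun x : σ → ℝ ↦ eval x p) (Measure.pi fun _ ↦ gaussianReal 0 1) := by
  induction p using MvPolynomial.induction_on' with
  | monomial s r =>
    simp only [eval_monomial_eq_prod]
    exact (Integrable.fintype_prod (f := fun i y ↦ y ^ s i)
      fun i ↦ integrable_pow_gaussianReal (s i)).const_mul r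
  | add p q hp hq =>
    simp only [map_add]
    exact hp.add hq

/-- The expectation of the polynomial `p`, evaluated at independent standard normal variables
indexed by `σ`, as a linear functional of `p`. -/
noncomputable def gaussianExpectation (σ : Type*) [Fintype σ] : MvPolynomial σ ℝ →ₗ[ℝ] ℝ where
  toFun p := ∫ x, eval x p ∂Measure.pi fun _ : σ ↦ gaussianReal 0 1
  map_add' p q := by
    simpa using integral_add (integrable_eval_pi_gaussianReal p) (integrable_eval_pi_gaussianReal q)
  map_smul' r p := by simp [smul_eval, integral_const_mul]

lemma gaussianExpectation_apply (p : MvPolynomial σ ℝ) :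
    gaussianExpectation σ p = ∫ x, eval x p ∂Measure.pi fun _ : σ ↦ gaussianReal 0 1 := rfl

lemma gaussianExpectation_monomial (s : σ →₀ ℕ) (r : ℝ) :
    gaussianExpectation σ (monomial s r) = r * ∏ i, ∫ y, y ^ s i ∂gaussianReal 0 1 := by
  simp only [gaussianExpectation_apply, eval_monomial_eq_prod, integral_const_mul]
  rw [integral_fintype_prod_eq_prod (f := fun i y ↦ y ^ s i)]

lemma gaussianExpectation_one : gaussianExpectation σ 1 = 1 := by
  simp [gaussianExpectation_apply]

/-- Gaussian integration by parts (Stein's identity) for polynomials. -/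
lemma gaussianExpectation_X_mul [DecidableEq σ] (i : σ) (p : MvPolynomial σ ℝ) :
    gaussianExpectation σ (X i * p) = gaussianExpectation σ (pderiv i p) := by
  induction p using MvPolynomial.induction_on' with
  | monomial s r =>
    rw [X, monomial_mul, pderiv_monomial, gaussianExpectation_monomial,
      gaussianExpectation_monomial, ← Finset.mul_prod_erase _ _ (Finset.mem_univ i),
      ← Finset.mul_prod_erase (a := i) (h := Finset.mem_univ i)]
    have h1 : (Finsupp.single i 1 + s : σ →₀ ℕ) i = s i + 1 := by simp [add_comm]
    have h2 : (s - Finsupp.single i 1 : σ →₀ ℕ) i = s i - 1 := by simp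
    have h3 : ∏ j ∈ Finset.univ.erase i, ∫ y : ℝ, y ^ (Finsupp.single i 1 + s : σ →₀ ℕ) j ∂gaussianReal 0 1
        = ∏ j ∈ Finset.univ.erase i,
          ∫ y : ℝ, y ^ (s - Finsupp.single i 1 : σ →₀ ℕ) j ∂gaussianReal 0 1 := by
      refine Finset.prod_congr rfl fun j hj ↦ ?_
      have hj : i ≠ j := (Finset.ne_of_mem_erase hj).symm
      simp [hj]
    rw [h1, h2, h3, integral_pow_succ_gaussianReal]
    ring
  | add p q hp hq => rw [mul_add, map_add, hp, hq, map_add, map_add]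

end Polynomial

/-! ### Recursions for the moments of the scatter matrix -/

section Scatter

open MvPolynomial

variable {τ ι : Type*} [Fintype τ]

/-- The entry `(i, j)` of the scatter matrix as a polynomial in the coordinates: the variable
`X (t, i)` is the `i`-th coordinate of the `t`-th vector. -/
noncomputable def scatterPoly (τ : Type*) {ι : Type*} [Fintype τ] (i j : ι) :
    MvPolynomial (τ × ι) ℝ :=
  ∑ t, X (t, i) * X (t, j)

lemma scatterPoly_comm (i j : ι) : scatterPoly τ i j = scatterPoly τ j i := by
  simp [scatterPoly, mul_comm]

variable [DecidableEq τ] [DecidableEq ι]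

lemma pderiv_scatterPoly_self (t : τ) (i : ι) :
    pderiv (t, i) (scatterPoly τ i i) = 2 * X (t, i) := by
  simp only [scatterPoly, map_sum, Derivation.leibniz, pderiv_X, smul_eq_mul]
  rw [Finset.sum_eq_single t]
  · simp [two_mul]
  · intro s _ hs
    simp [hs]
  · simp

lemma pderiv_scatterPoly_left (t : τ) {i j : ι} (hij : i ≠ j) :
    pderiv (t, i) (scatterPoly τ i j) = X (t, j) := by
  simp only [scatterPoly, map_sum, Derivation.leibniz, pderiv_X, smul_eq_mul]
  rw [Finset.sum_eq_single t]
  · simp [hij.symm]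
  · intro s _ hs
    simp [hs]
  · simp

lemma pderiv_scatterPoly_of_ne (t : τ) {i j : ι} (hij : i ≠ j) :
    pderiv (t, i) (scatterPoly τ j j) = 0 := by
  simp [scatterPoly, map_sum, Derivation.leibniz, pderiv_X, hij.symm]

variable [Fintype ι]

/-- Integration by parts in all the coordinates `(t, i)`: the Euler operator
`∑ t, ∂_{(t, i)} (X (t, i) * ·)` multiplies the monomial by the constant on the right. -/
lemma gaussianExpectation_scatterPoly_succ {i j : ι} (hij : i ≠ j) (k b c : ℕ) :
    gaussianExpectation (τ × ι)
        (scatterPoly τ i j ^ k * scatterPoly τ i i ^ (b + 1) * scatterPoly τ j j ^ c) =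
      (Fintype.card τ + k + 2 * b) * gaussianExpectation (τ × ι)
        (scatterPoly τ i j ^ k * scatterPoly τ i i ^ b * scatterPoly τ j j ^ c) := by
  set m := scatterPoly τ i j ^ k * scatterPoly τ i i ^ b * scatterPoly τ j j ^ c with hm
  have h1 : scatterPoly τ i j ^ k * scatterPoly τ i i ^ (b + 1) * scatterPoly τ j j ^ c =
      ∑ t, X (t, i) * (X (t, i) * m) := by
    simp only [← mul_assoc, ← Finset.sum_mul]
    rw [hm, ← scatterPoly]
    ring
  have hpow (q : MvPolynomial (τ × ι) ℝ) (n : ℕ) : (n : MvPolynomial (τ × ι) ℝ) * q ^ (n - 1) * q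
      = n * q ^ n := by
    cases n with
    | zero => simp
    | succ n => simp [pow_succ, mul_assoc]
  have h2 (t : τ) : pderiv (t, i) (X (t, i) * m) = m
      + (X (t, i) * X (t, j)) * ((k : MvPolynomial (τ × ι) ℝ) * scatterPoly τ i j ^ (k - 1) * scatterPoly τ i i ^ b *
          scatterPoly τ j j ^ c)
      + (X (t, i) * X (t, i)) * (2 * (b : MvPolynomial (τ × ι) ℝ) * scatterPoly τ i i ^ (b - 1) * scatterPoly τ i j ^ k *
          scatterPoly τ j j ^ c) := by
    simp only [hm, Derivation.leibniz, Derivation.leibniz_pow, pderiv_scatterPoly_self,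
      pderiv_scatterPoly_left t hij, pderiv_scatterPoly_of_ne t hij, smul_eq_mul, nsmul_eq_mul,
      pderiv_X_self]
    ring
  have h3 : ∑ t, pderiv (t, i) (X (t, i) * m) = (Fintype.card τ + k + 2 * b : ℝ) • m := by
    simp only [h2, Finset.sum_add_distrib, ← Finset.sum_mul]
    rw [← scatterPoly, ← scatterPoly, smul_eq_C_mul, Finset.sum_const, Finset.card_univ,
      nsmul_eq_mul]
    simp only [map_add, map_mul, map_natCast, map_ofNat]
    linear_combination scatterPoly τ i i ^ b * scatterPoly τ j j ^ c * hpow (scatterPoly τ i j) k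
      + 2 * scatterPoly τ i j ^ k * scatterPoly τ j j ^ c * hpow (scatterPoly τ i i) b
  rw [h1, map_sum]
  simp only [gaussianExpectation_X_mul]
  rw [← map_sum, h3, map_smul, smul_eq_mul]

lemma gaussianExpectation_scatterPoly {i j : ι} (hij : i ≠ j) (k b c : ℕ) :
    gaussianExpectation (τ × ι)
        (scatterPoly τ i j ^ k * scatterPoly τ i i ^ b * scatterPoly τ j j ^ c) =
      gaussianExpectation (τ × ι) (scatterPoly τ i j ^ k) *
        (∏ l ∈ Finset.range b, ((Fintype.card τ : ℝ) + k + 2 * l)) *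
        ∏ l ∈ Finset.range c, ((Fintype.card τ : ℝ) + k + 2 * l) := by
  induction b with
  | succ b ih => rw [gaussianExpectation_scatterPoly_succ hij, ih, Finset.prod_range_succ]; ring
  | zero =>
    induction c with
    | zero => simp
    | succ c ih =>
      -- the same recursion with the roles of `i` and `j` exchanged
      have h := gaussianExpectation_scatterPoly_succ (τ := τ) hij.symm k c 0
      rw [scatterPoly_comm j i] at h
      simp only [pow_zero, mul_one] at h ih ⊢
      rw [h, ih, Finset.prod_range_succ]
      ring

/-- Integration by parts in the coordinates `(t, i)`, one factor `∑ t, X (t, i) * X (t, j)` being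
split off. For `k = 0` the factor `k` makes the truncated exponent `k - 1` irrelevant. -/
lemma gaussianExpectation_scatterPoly_pow_succ {i j : ι} (hij : i ≠ j) (k : ℕ) :
    gaussianExpectation (τ × ι) (scatterPoly τ i j ^ (k + 1)) =
      k * gaussianExpectation (τ × ι) (scatterPoly τ i j ^ (k - 1) * scatterPoly τ j j) := by
  have h1 : scatterPoly τ i j ^ (k + 1) =
      ∑ t, X (t, i) * (X (t, j) * scatterPoly τ i j ^ k) := by
    simp only [← mul_assoc, ← Finset.sum_mul]
    rw [← scatterPoly, pow_succ']
  have h2 (t : τ) : pderiv (t, i) (X (t, j) * scatterPoly τ i j ^ k) =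
      (X (t, j) * X (t, j)) * ((k : MvPolynomial (τ × ι) ℝ) * scatterPoly τ i j ^ (k - 1)) := by
    have hne : (t, j) ≠ (t, i) := by simp [hij.symm]
    simp only [Derivation.leibniz, Derivation.leibniz_pow, pderiv_scatterPoly_left t hij,
      smul_eq_mul, nsmul_eq_mul, pderiv_X_of_ne hne]
    ring
  have h3 : ∑ t, pderiv (t, i) (X (t, j) * scatterPoly τ i j ^ k) =
      (k : ℝ) • (scatterPoly τ i j ^ (k - 1) * scatterPoly τ j j) := by
    simp only [h2, ← Finset.sum_mul]
    rw [← scatterPoly, smul_eq_C_mul, map_natCast]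
    ring
  rw [h1, map_sum]
  simp only [gaussianExpectation_X_mul]
  rw [← map_sum, h3, map_smul, smul_eq_mul]

lemma gaussianExpectation_scatterPoly_pow_add_two {i j : ι} (hij : i ≠ j) (k : ℕ) :
    gaussianExpectation (τ × ι) (scatterPoly τ i j ^ (k + 2)) =
      (k + 1) * (Fintype.card τ + k) * gaussianExpectation (τ × ι) (scatterPoly τ i j ^ k) := by
  have h := gaussianExpectation_scatterPoly (τ := τ) hij k 0 1
  simp only [pow_zero, pow_one, mul_one, Finset.range_zero, Finset.prod_empty,
    Finset.range_one, Finset.prod_singleton] at h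
  rw [gaussianExpectation_scatterPoly_pow_succ hij, Nat.add_sub_cancel, h]
  push_cast
  ring

lemma gaussianExpectation_scatterPoly_pow_odd {i j : ι} (hij : i ≠ j) {k : ℕ} (hk : Odd k) :
    gaussianExpectation (τ × ι) (scatterPoly τ i j ^ k) = 0 := by
  obtain ⟨n, rfl⟩ := hk
  induction n with
  | zero => simpa using gaussianExpectation_scatterPoly_pow_succ (τ := τ) hij 0
  | succ n ih =>
    rw [show 2 * (n + 1) + 1 = 2 * n + 1 + 2 by ring,
      gaussianExpectation_scatterPoly_pow_add_two hij, ih, mul_zero]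

lemma gaussianExpectation_scatterPoly_pow_even {i j : ι} (hij : i ≠ j) (a : ℕ) :
    gaussianExpectation (τ × ι) (scatterPoly τ i j ^ (2 * a)) =
      ((2 * a - 1)‼ : ℝ) * ∏ l ∈ Finset.range a, ((Fintype.card τ : ℝ) + 2 * l) := by
  induction a with
  | zero => simp [gaussianExpectation_one]
  | succ a ih =>
    have hfac : (2 * (a + 1) - 1)‼ = (2 * a + 1) * (2 * a - 1)‼ := by
      cases a with
      | zero => rfl
      | succ a => exact Nat.doubleFactorial_add_two (2 * a + 1)
    rw [mul_add_one, gaussianExpectation_scatterPoly_pow_add_two hij, ih, ← mul_add_one, hfac,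
      Finset.prod_range_succ]
    push_cast
    ring

end Scatter

/-! ### Transfer to the Wishart distribution -/

/-- The coordinates of independent `N(0, I)` vectors are jointly independent standard normal
variables. -/
lemma measurePreserving_coord_pi_multivariateGaussian {τ ι : Type*} [Fintype τ] [Fintype ι]
    [DecidableEq ι] :
    MeasurePreserving (fun (x : τ → EuclideanSpace ℝ ι) (q : τ × ι) ↦ x q.1 q.2)
      (Measure.pi fun _ ↦ multivariateGaussian 0 1) (Measure.pi fun _ ↦ gaussianReal 0 1) where
  measurable := by fun_prop
  map_eq := by
    refine (Measure.pi_eq fun s hs ↦ ?_).symm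
    have hpre : (fun (x : τ → EuclideanSpace ℝ ι) (q : τ × ι) ↦ x q.1 q.2) ⁻¹' Set.univ.pi s =
        Set.univ.pi fun t ↦ {y : EuclideanSpace ℝ ι | ∀ j, y j ∈ s (t, j)} := by
      ext x
      simp [Set.mem_pi]
    have hpt (t : τ) : multivariateGaussian 0 1 {y : EuclideanSpace ℝ ι | ∀ j, y j ∈ s (t, j)} =
        ∏ j, gaussianReal 0 1 (s (t, j)) := by
      have hms : MeasurableSet {y : EuclideanSpace ℝ ι | ∀ j, y j ∈ s (t, j)} := by
        simp only [Set.ofPred_forall]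
        exact .iInter fun j ↦
          (by fun_prop : Measurable fun y : EuclideanSpace ℝ ι ↦ y j) (hs (t, j))
      rw [multivariateGaussian_zero_one, ← map_pi_eq_stdGaussian,
        Measure.map_apply (by fun_prop) hms, ← Measure.pi_pi]
      congr 1
      ext x
      simp [Set.mem_pi]
    rw [Measure.map_apply (by fun_prop) (.univ_pi hs), hpre, Measure.pi_pi,
      Fintype.prod_prod_type]
    exact Finset.prod_congr rfl fun t _ ↦ hpt t

open MvPolynomial in
/-- Polynomial functions of a Wishart matrix with identity scale are integrable, and their
expectations are Gaussian expectations of the polynomials in the entries `scatterPoly`. -/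
lemma integrable_and_integral_wishart_one {Ω : Type*} [MeasurableSpace Ω] {P : Measure Ω} {p ν : ℕ}
    {W : Ω → Matrix (Fin p) (Fin p) ℝ} (hW : HasLaw W (wishart p ν 1) P)
    (q : MvPolynomial (Fin p × Fin p) ℝ) :
    Integrable (fun ω ↦ eval (fun e ↦ W ω e.1 e.2) q) P ∧
    ∫ ω, eval (fun e ↦ W ω e.1 e.2) q ∂P = gaussianExpectation (Fin ν × Fin p)
      (aeval (fun e : Fin p × Fin p ↦ scatterPoly (Fin ν) e.1 e.2) q) := by
  have hmeas : Measurable fun w : Matrix (Fin p) (Fin p) ℝ ↦ eval (fun e ↦ w e.1 e.2) q := by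
    refine (continuous_eval q).measurable.comp (measurable_pi_lambda _ fun e ↦ ?_)
    exact (measurable_pi_apply e.2).comp (measurable_pi_apply (X := fun _ ↦ Fin p → ℝ) e.1)
  have hmp := measurePreserving_coord_pi_multivariateGaussian (τ := Fin ν) (ι := Fin p)
  have hint := integrable_eval_pi_gaussianReal
    (aeval (fun e : Fin p × Fin p ↦ scatterPoly (Fin ν) e.1 e.2) q)
  have heval (x : Fin ν → EuclideanSpace ℝ (Fin p)) :
      eval (fun e ↦ scatterMatrix x e.1 e.2) q = eval (fun s : Fin ν × Fin p ↦ x s.1 s.2)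
        (aeval (fun e : Fin p × Fin p ↦ scatterPoly (Fin ν) e.1 e.2) q) := by
    clear hmeas hint
    induction q using MvPolynomial.induction_on with
    | C r => simp
    | add q₁ q₂ h₁ h₂ => simp only [map_add, h₁, h₂]
    | mul_X q₁ e h₁ =>
      rw [map_mul, map_mul, map_mul, h₁]
      simp [scatterMatrix, scatterPoly]
  constructor
  · refine (integrable_map_measure hmeas.aestronglyMeasurable hW.aemeasurable).1 ?_
    rw [hW.map_eq, wishart, integrable_map_measure hmeas.aestronglyMeasurable
      measurable_scatterMatrix.aemeasurable]
    exact (hmp.integrable_comp_of_integrable hint).congr (.of_forall fun x ↦ (heval x).symm)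
  · rw [← integral_map hW.aemeasurable hmeas.aestronglyMeasurable, hW.map_eq, wishart,
      integral_map measurable_scatterMatrix.aemeasurable hmeas.aestronglyMeasurable,
      gaussianExpectation_apply, ← hmp.map_eq,
      integral_map hmp.aemeasurable (by rw [hmp.map_eq]; exact hint.aestronglyMeasurable)]
    exact integral_congr_ae (.of_forall heval)

open MvPolynomial in
/-- The case of the monomials in the entries of a `2 × 2` matrix. -/
lemma integrable_and_integral_monomial_wishart_one {Ω : Type*} [MeasurableSpace Ω] {P : Measure Ω}
    {ν : ℕ} {W : Ω → Matrix (Fin 2) (Fin 2) ℝ} (hW : HasLaw W (wishart 2 ν 1) P) (k b c : ℕ) :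
    Integrable (fun ω ↦ W ω 0 1 ^ k * W ω 0 0 ^ b * W ω 1 1 ^ c) P ∧
    ∫ ω, W ω 0 1 ^ k * W ω 0 0 ^ b * W ω 1 1 ^ c ∂P =
      gaussianExpectation (Fin ν × Fin 2) (scatterPoly (Fin ν) 0 1 ^ k) *
        (∏ l ∈ Finset.range b, ((ν : ℝ) + k + 2 * l)) *
        ∏ l ∈ Finset.range c, ((ν : ℝ) + k + 2 * l) := by
  have h := integrable_and_integral_wishart_one hW (X (0, 1) ^ k * X (0, 0) ^ b * X (1, 1) ^ c)
  simp only [map_mul, map_pow, eval_X, aeval_X] at h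
  rwa [gaussianExpectation_scatterPoly zero_ne_one, Fintype.card_fin] at h

lemma prod_Icc_one_sub_eq_prod_range {R M : Type*} [Ring R] [CommMonoid M] (f : R → M) (n : ℕ) :
    ∏ i ∈ Finset.Icc 1 n, f ((n : R) - i) = ∏ l ∈ Finset.range n, f l := by
  refine Finset.prod_nbij' (fun i ↦ n - i) (fun l ↦ n - l) ?_ ?_ ?_ ?_ ?_
  · intro i hi
    simp only [Finset.mem_Icc, Finset.mem_range] at hi ⊢
    lia
  · intro l hl
    simp only [Finset.mem_Icc, Finset.mem_range] at hl ⊢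
    lia
  · intro i hi
    simp only [Finset.mem_Icc] at hi
    lia
  · intro l hl
    simp only [Finset.mem_range] at hl
    lia
  · intro i hi
    rw [Nat.cast_sub (Finset.mem_Icc.1 hi).2]

/-- Moments of the `2 × 2` real Wishart distribution `W_2(ν, I)`. The entries `w_11`, `w_12`,
`w_22` are `W ω 0 0`, `W ω 0 1`, `W ω 1 1`. For `a = 0` the double factorial `(2 * a - 1)‼` is
`0‼ = 1`, which agrees with the convention `(-1)!! = 1`. -/
theorem theorem4 {Ω : Type*} [MeasurableSpace Ω] {P : Measure Ω} (ν : ℕ)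
    (W : Ω → Matrix (Fin 2) (Fin 2) ℝ) (hW : HasLaw W (wishart 2 ν 1) P) :
    (∀ a b c : ℕ,
      Integrable (fun ω ↦ W ω 0 1 ^ (2 * a) * W ω 0 0 ^ b * W ω 1 1 ^ c) P ∧
      ∫ ω, W ω 0 1 ^ (2 * a) * W ω 0 0 ^ b * W ω 1 1 ^ c ∂P =
        ((2 * a - 1)‼ : ℝ) *
          (∏ i ∈ Finset.Icc 1 a, ((ν : ℝ) + 2 * ((a : ℝ) - (i : ℝ)))) *
          (∏ i ∈ Finset.Icc 1 b, ((ν : ℝ) + 2 * ((a : ℝ) + (b : ℝ) - (i : ℝ)))) *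
          (∏ i ∈ Finset.Icc 1 c, ((ν : ℝ) + 2 * ((a : ℝ) + (c : ℝ) - (i : ℝ))))) ∧
    (∀ k b c : ℕ, Odd k →
      Integrable (fun ω ↦ W ω 0 1 ^ k * W ω 0 0 ^ b * W ω 1 1 ^ c) P ∧
      ∫ ω, W ω 0 1 ^ k * W ω 0 0 ^ b * W ω 1 1 ^ c ∂P = 0) := by
  refine ⟨fun a b c ↦ ?_, fun k b c hk ↦ ?_⟩
  · have h := integrable_and_integral_monomial_wishart_one hW (2 * a) b c
    refine ⟨h.1, ?_⟩
    have hprod (n : ℕ) : ∏ i ∈ Finset.Icc 1 n, ((ν : ℝ) + 2 * ((a : ℝ) + (n : ℝ) - (i : ℝ))) =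
        ∏ l ∈ Finset.range n, ((ν : ℝ) + (2 * a : ℕ) + 2 * l) := by
      rw [← prod_Icc_one_sub_eq_prod_range (fun y : ℝ ↦ (ν : ℝ) + (2 * a : ℕ) + 2 * y)]
      refine Finset.prod_congr rfl fun i _ ↦ ?_
      push_cast
      ring
    rw [h.2, gaussianExpectation_scatterPoly_pow_even zero_ne_one, Fintype.card_fin, hprod, hprod,
      prod_Icc_one_sub_eq_prod_range (fun y : ℝ ↦ (ν : ℝ) + 2 * y)]
  · have h := integrable_and_integral_monomial_wishart_one hW k b c
    refine ⟨h.1, ?_⟩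
    rw [h.2, gaussianExpectation_scatterPoly_pow_odd zero_ne_one hk, zero_mul, zero_mul]
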